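/- Let $(\Omega,\mathcal F,P)$ be a probability space and $\{\mathcal F_n\}_{n\ge0}$ a nondecreasing sequence of sub-$\sigma$-algebras of $\mathcal F$ with $\mathcal F_0=\{\emptyset,\Omega\}$ and $\mathcal F=\sigma(\bigcup_n\mathcal F_n)$. A set $B\in\mathcal F_n$ is called an atom of $\mathcal F_n$ if every $A\subset B$ with $A\in\mathcal F_n$ satisfies $P(A)=P(B)$ or $P(A)=0$; suppose that every $\mathcal F_n$ is generated by countably many atoms, and let $A(\mathcal F_n)$ denote the set of atoms of $\mathcal F_n$ of positive probability. Suppose that $\{\mathcal F_n\}$ is regular, that is, for some $R\ge2$ every non-negative martingale $(f_n)_{n\ge0}$ satisfies $f_n\le Rf_{n-1}$ almost surely for all $n\ge1$. Let $\alpha>0$. Functions are real-valued throughout, or complex-valued throughout. Write $E$ for the expectation and $E_n$ for the conditional expectation relative to $\mathcal F_n$. For $f\in L_1$ let $$\|f\|_{\mathrm{Lip}_\alpha}=\sup_{n\ge0}\ \sup_{B\in A(\mathcal F_n)}\frac1{P(B)^\alpha}\,\frac1{P(B)}\int_B|f-E_nf|\,dP,\qquad \|f\|_{\mathrm{Lip}^\natural_\alpha}=\|f\|_{\mathrm{Lip}_\alpha}+|Ef|,$$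 and let $\mathrm{Lip}_\alpha$ and $\mathrm{Lip}^\natural_\alpha$ be the sets of those $f\in L_1$ for which $\|f\|_{\mathrm{Lip}_\alpha}<\infty$ and $\|f\|_{\mathrm{Lip}^\natural_\alpha}<\infty$, respectively. Let $\mathrm{PWM}(\mathrm{Lip}^\natural_\alpha)$ be the set of all $\mathcal F$-measurable functions $g$ such that $fg\in\mathrm{Lip}^\natural_\alpha$ for every $f\in\mathrm{Lip}^\natural_\alpha$, and for such $g$ let $$\|g\|_{Op}=\sup\left\{\frac{\|fg\|_{\mathrm{Lip}^\natural_\alpha}}{\|f\|_{\mathrm{Lip}^\natural_\alpha}} : f\in\mathrm{Lip}^\natural_\alpha,\ f \text{ not almost surely } 0\right\}.$$ Then $$\mathrm{PWM}(\mathrm{Lip}^\natural_\alpha)=\mathrm{Lip}_\alpha\cap L_\infty .$$ Moreover, there is a constant $C>0$, depending only on $\alpha$ and $R$, such that for every $g\in\mathrm{PWM}(\mathrm{Lip}^\natural_\alpha)$ $$C^{-1}\|g\|_{Op}\le\|g\|_{\mathrm{Lip}_\alpha}+\|g\|_{L_\infty}\le C\,\|g\|_{Op}.$$ -/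

import Mathlib

open MeasureTheory
open scoped ENNReal NNReal

namespace MartingaleCampanato

/-- `B` is an atom of the σ-algebra `𝓐` with respect to `P`: `B ∈ 𝓐`, and every `A ⊆ B` with
`A ∈ 𝓐` satisfies `P A = P B` or `P A = 0`. (Null sets are atoms in this sense; they are left out
wherever one divides by `P B`.) -/
def IsAtom {Ω : Type*} {m : MeasurableSpace Ω} (P : Measure Ω) (𝓐 : MeasurableSpace Ω)
    (B : Set Ω) : Prop :=
  MeasurableSet[𝓐] B ∧ ∀ A ⊆ B, MeasurableSet[𝓐] A → P A = P B ∨ P A = 0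

/-- The σ-algebra `𝓐` is generated by countably many atoms. -/
def CountablyAtomic {Ω : Type*} {m : MeasurableSpace Ω} (P : Measure Ω)
    (𝓐 : MeasurableSpace Ω) : Prop :=
  ∃ S : Set (Set Ω), S.Countable ∧ (∀ B ∈ S, IsAtom P 𝓐 B) ∧ 𝓐 = MeasurableSpace.generateFrom S

/-- The filtration is regular with constant `R`: `f_n ≤ R f_{n-1}` almost surely, `n ≥ 1`, for all
non-negative martingales. -/
def IsRegularWith {Ω : Type*} {m : MeasurableSpace Ω} (ℱ : Filtration ℕ m) (P : Measure Ω)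
    (R : ℝ) : Prop :=
  ∀ f : ℕ → Ω → ℝ, Martingale f ℱ P → (∀ n, 0 ≤ᵐ[P] f n) →
    ∀ n, ∀ᵐ ω ∂P, f (n + 1) ω ≤ R * f n ω

section Spaces

variable {Ω : Type*} {m : MeasurableSpace Ω} {𝕜 : Type*} [RCLike 𝕜]

/-- The space `L₁` of integrable measurable functions. -/
def L1 (𝕜 : Type*) [RCLike 𝕜] (P : Measure Ω) : Set (Ω → 𝕜) :=
  {f | Measurable f ∧ Integrable f P}

/-- The space `L_∞` of essentially bounded measurable functions. -/
def Linfty (𝕜 : Type*) [RCLike 𝕜] (P : Measure Ω) : Set (Ω → 𝕜) :=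
  {f | Measurable f ∧ MemLp f ∞ P}

/-- The Campanato seminorm
`sup_n sup_B φ(P B)⁻¹ (P(B)⁻¹ ∫_B |f - E_n f|^p dP)^(1/p)`, where `B` runs over the atoms of
`ℱ n` of positive probability; only the values of `φ` on `(0, 1]` matter. -/
noncomputable def campanatoSeminorm (ℱ : Filtration ℕ m) (P : Measure Ω) (p : ℝ) (φ : ℝ → ℝ)
    (f : Ω → 𝕜) : ℝ≥0∞ :=
  ⨆ (n : ℕ) (B : Set Ω) (_ : IsAtom P (ℱ n) B) (_ : P B ≠ 0),
    (⨍⁻ ω in B, ‖f ω - (P[f | ℱ n]) ω‖ₑ ^ p ∂P) ^ (1 / p) / ENNReal.ofReal (φ (P.real B))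

/-- The Campanato norm: the Campanato seminorm plus `|E f|`. -/
noncomputable def campanatoNorm (ℱ : Filtration ℕ m) (P : Measure Ω) (p : ℝ) (φ : ℝ → ℝ)
    (f : Ω → 𝕜) : ℝ≥0∞ :=
  campanatoSeminorm ℱ P p φ f + ‖∫ ω, f ω ∂P‖ₑ

/-- The seminorm of `Lip_α`, that is `p = 1`, `φ(r) = r ^ α`. -/
noncomputable def lipSeminorm (ℱ : Filtration ℕ m) (P : Measure Ω) (α : ℝ) (f : Ω → 𝕜) : ℝ≥0∞ :=
  campanatoSeminorm ℱ P 1 (fun r => r ^ α) f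

/-- The norm of `Lip♮_α`, that is `p = 1`, `φ(r) = r ^ α`. -/
noncomputable def lipNorm (ℱ : Filtration ℕ m) (P : Measure Ω) (α : ℝ) (f : Ω → 𝕜) : ℝ≥0∞ :=
  campanatoNorm ℱ P 1 (fun r => r ^ α) f

/-- The space `Lip_α` of the `f ∈ L₁` with finite `Lip_α`-seminorm. -/
def Lip (𝕜 : Type*) [RCLike 𝕜] (ℱ : Filtration ℕ m) (P : Measure Ω) (α : ℝ) : Set (Ω → 𝕜) :=
  {f | f ∈ L1 𝕜 P ∧ lipSeminorm ℱ P α f < ∞}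

/-- The space `Lip♮_α` of the `f ∈ L₁` with finite `Lip♮_α`-norm. -/
def LipNat (𝕜 : Type*) [RCLike 𝕜] (ℱ : Filtration ℕ m) (P : Measure Ω) (α : ℝ) : Set (Ω → 𝕜) :=
  {f | f ∈ L1 𝕜 P ∧ lipNorm ℱ P α f < ∞}

/-- The set of pointwise multipliers on a space `X` of measurable functions. -/
def PWM {Ω : Type*} [MeasurableSpace Ω] (X : Set (Ω → 𝕜)) : Set (Ω → 𝕜) :=
  {g | Measurable g ∧ ∀ f ∈ X, f * g ∈ X}

/-- The operator norm of the multiplication by `g` on the space `X` with norm `N`: the supremum of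
`N (f g) / N f` over the `f ∈ X` that are not almost surely zero. -/
noncomputable def opNorm (P : Measure Ω) (X : Set (Ω → 𝕜)) (N : (Ω → 𝕜) → ℝ≥0∞) (g : Ω → 𝕜) :
    ℝ≥0∞ :=
  ⨆ (f : Ω → 𝕜) (_ : f ∈ X) (_ : ¬ f =ᵐ[P] 0), N (f * g) / N f

end Spaces

end MartingaleCampanato

/-!
Everything rests on `Lip♮_α ⊆ L_∞`. If an atom `A` of `ℱ (n + 1)` lies in an atom `B` of `ℱ n` and
is not all of it, regularity gives `P(B) / R ≤ P(A) ≤ (1 - 1 / R) P(B)`. The left inequality bounds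
the jump of the average by `|f_A - f_B| ≤ R ‖f‖_Lip P(B) ^ α`. By the right one these jumps decay
geometrically along a chain of atoms: for a suitable `K`, depending only on `α` and `R`, the
quantity `|f_B| + K ‖f‖_Lip P(B) ^ α` does not increase when passing to a smaller atom. Starting
from `Ω` this gives `|f_B| ≤ |E f| + K ‖f‖_Lip` for all atoms, hence, by martingale convergence,
`‖f‖_∞ ≤ K ‖f‖_{Lip♮}`. Sufficiency then follows from the product estimate
`‖f g‖_Lip ≤ 2 (‖f‖_∞ ‖g‖_Lip + ‖g‖_∞ ‖f‖_Lip)`, and necessity from testing a multiplier on the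
constant function `1`.
-/

namespace MartingaleCampanato

section MeanOscillation

variable {Ω : Type*} {m : MeasurableSpace Ω} {μ : Measure Ω}
  {E : Type*} [NormedAddCommGroup E] [NormedSpace ℝ E] {f : Ω → E}

/-- The mean oscillation `⨍ ‖f - ⨍ f‖`; over a set `B` it is taken with respect to
`μ.restrict B`. -/
noncomputable def meanOscillation (μ : Measure Ω) (f : Ω → E) : ℝ≥0∞ :=
  ⨍⁻ ω, ‖f ω - ⨍ x, f x ∂μ‖ₑ ∂μ

theorem enorm_average_le_laverage_enorm (μ : Measure Ω) (f : Ω → E) :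
    ‖⨍ ω, f ω ∂μ‖ₑ ≤ ⨍⁻ ω, ‖f ω‖ₑ ∂μ :=
  enorm_integral_le_lintegral_enorm f

theorem enorm_average_le_eLpNorm_top (μ : Measure Ω) (f : Ω → E) :
    ‖⨍ ω, f ω ∂μ‖ₑ ≤ eLpNorm f ∞ μ :=
  (enorm_average_le_laverage_enorm μ f).trans (laverage_le_essSup _)

theorem laverage_mono_measure {ν : Measure Ω} (hμν : μ ≤ ν) {r : ℝ≥0∞}
    (hr : ν Set.univ ≤ r * μ Set.univ) (hμ₀ : μ Set.univ ≠ 0) (hν : ν Set.univ ≠ ∞)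
    (f : Ω → ℝ≥0∞) : ⨍⁻ ω, f ω ∂μ ≤ r * ⨍⁻ ω, f ω ∂ν := by
  have hν₀ : ν Set.univ ≠ 0 := fun h => hμ₀ (le_zero_iff.mp (h ▸ hμν _))
  have hinv : (μ Set.univ)⁻¹ ≤ r * (ν Set.univ)⁻¹ := by
    rw [← div_eq_mul_inv, ENNReal.le_div_iff_mul_le (.inl hν₀) (.inl hν), mul_comm,
      ← div_eq_mul_inv]
    exact ENNReal.div_le_of_le_mul hr
  rw [laverage_eq, laverage_eq, div_eq_mul_inv, div_eq_mul_inv, mul_left_comm]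
  gcongr

variable [IsFiniteMeasure μ] [NeZero μ]

theorem meanOscillation_const [CompleteSpace E] (c : E) :
    meanOscillation μ (fun _ => c) = 0 := by
  simp [meanOscillation]

theorem enorm_average_sub_le [CompleteSpace E] (hf : Integrable f μ) (c : E) :
    ‖⨍ ω, f ω ∂μ - c‖ₑ ≤ ⨍⁻ ω, ‖f ω - c‖ₑ ∂μ := by
  have h : ⨍ ω, (f ω - c) ∂μ = ⨍ ω, f ω ∂μ - c := by
    rw [average, integral_sub hf.to_average (integrable_const c), integral_const]
    simp [average]
  exact h ▸ enorm_average_le_laverage_enorm μ fun ω => f ω - c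

theorem laverage_add_const (f : Ω → ℝ≥0∞) (c : ℝ≥0∞) :
    ⨍⁻ ω, (f ω + c) ∂μ = ⨍⁻ ω, f ω ∂μ + c := by
  rw [laverage, lintegral_add_right _ measurable_const, ← laverage, ← laverage, laverage_const]

theorem laverage_enorm_le (f : Ω → E) :
    ⨍⁻ ω, ‖f ω‖ₑ ∂μ ≤ ‖⨍ ω, f ω ∂μ‖ₑ + meanOscillation μ f := by
  rw [add_comm, meanOscillation, ← laverage_add_const]
  exact laverage_mono_ae (ae_of_all _ fun ω => by
    simpa using enorm_add_le (f ω - ⨍ x, f x ∂μ) (⨍ x, f x ∂μ))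

theorem meanOscillation_le_two_mul [CompleteSpace E] (hf : Integrable f μ) (c : E) :
    meanOscillation μ f ≤ 2 * ⨍⁻ ω, ‖f ω - c‖ₑ ∂μ :=
  calc meanOscillation μ f
      ≤ ⨍⁻ ω, (‖f ω - c‖ₑ + ‖⨍ x, f x ∂μ - c‖ₑ) ∂μ :=
        laverage_mono_ae (ae_of_all _ fun ω => by
          simpa using enorm_sub_le (a := f ω - c) (b := ⨍ x, f x ∂μ - c))
    _ = ⨍⁻ ω, ‖f ω - c‖ₑ ∂μ + ‖⨍ x, f x ∂μ - c‖ₑ := laverage_add_const _ _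
    _ ≤ 2 * ⨍⁻ ω, ‖f ω - c‖ₑ ∂μ := by
        rw [two_mul]
        gcongr
        exact enorm_average_sub_le hf c

theorem meanOscillation_mul_le {A : Type*} [NormedRing A] [NormedAlgebra ℝ A] [CompleteSpace A]
    {f g : Ω → A} (hf : Integrable f μ) (hg : Integrable g μ) (hfg : Integrable (f * g) μ) :
    meanOscillation μ (f * g) ≤
      2 * (eLpNorm f ∞ μ * meanOscillation μ g + eLpNorm g ∞ μ * meanOscillation μ f) := by
  set a := ⨍ x, f x ∂μ
  set b := ⨍ x, g x ∂μ
  have hpt : ∀ᵐ ω ∂μ, ‖(f * g) ω - a * b‖ₑ ≤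
      eLpNorm f ∞ μ * ‖g ω - b‖ₑ + eLpNorm g ∞ μ * ‖f ω - a‖ₑ := by
    filter_upwards [ae_le_eLpNormEssSup (f := f) (μ := μ)] with ω hω
    have hsplit : (f * g) ω - a * b = f ω * (g ω - b) + (f ω - a) * b := by
      simp only [Pi.mul_apply]; noncomm_ring
    calc ‖(f * g) ω - a * b‖ₑ ≤ ‖f ω‖ₑ * ‖g ω - b‖ₑ + ‖f ω - a‖ₑ * ‖b‖ₑ := by
          rw [hsplit]
          exact (enorm_add_le _ _).trans (add_le_add enorm_smul_le enorm_smul_le)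
      _ ≤ _ := by
          rw [mul_comm ‖f ω - a‖ₑ]
          gcongr
          · exact hω
          · exact enorm_average_le_eLpNorm_top μ g
  calc meanOscillation μ (f * g) ≤ 2 * ⨍⁻ ω, ‖(f * g) ω - a * b‖ₑ ∂μ :=
        meanOscillation_le_two_mul hfg _
    _ ≤ 2 * ⨍⁻ ω, (eLpNorm f ∞ μ * ‖g ω - b‖ₑ + eLpNorm g ∞ μ * ‖f ω - a‖ₑ) ∂μ := by
        gcongr
        exact hpt
    _ = _ := by
        have hga : AEMeasurable (fun ω => ‖g ω - b‖ₑ) ((μ Set.univ)⁻¹ • μ) :=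
          (hg.to_average.sub (integrable_const b)).aestronglyMeasurable.enorm
        have hfa : AEMeasurable (fun ω => ‖f ω - a‖ₑ) ((μ Set.univ)⁻¹ • μ) :=
          (hf.to_average.sub (integrable_const a)).aestronglyMeasurable.enorm
        rw [laverage, lintegral_add_left' (hga.const_mul _), lintegral_const_mul'' _ hga,
          lintegral_const_mul'' _ hfa]
        rfl

end MeanOscillation

section Atoms

variable {Ω : Type*} {𝓐 m : MeasurableSpace Ω} {P : Measure Ω} {B : Set Ω}

theorem isAtom_compl_sUnion {S : Set (Set Ω)} (hS : S.Countable) :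
    IsAtom P (MeasurableSpace.generateFrom S) (⋃₀ S)ᶜ := by
  refine ⟨(MeasurableSet.sUnion hS fun B => MeasurableSpace.measurableSet_generateFrom).compl,
    fun A hA hAm => ?_⟩
  -- The sets containing or avoiding `(⋃₀ S)ᶜ` form a σ-algebra, which contains `S`.
  have hle : MeasurableSpace.generateFrom S ≤
      MeasurableSpace.map (Subtype.val : ↥(⋃₀ S)ᶜ → Ω) ⊥ := by
    refine MeasurableSpace.generateFrom_le fun s hs =>
      MeasurableSpace.measurableSet_bot_iff.mpr (.inl ?_)
    exact Set.eq_empty_of_forall_notMem fun x hx => x.2 ⟨s, hs, hx⟩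
  rcases MeasurableSpace.measurableSet_bot_iff.mp (hle A hAm) with h | h
  · rw [Subtype.preimage_coe_eq_empty, Set.inter_eq_right.mpr hA] at h
    simp [h]
  · rw [Set.preimage_eq_univ_iff, Subtype.range_coe] at h
    exact .inl (by rw [hA.antisymm h])

theorem CountablyAtomic.exists_cover (h : CountablyAtomic P 𝓐) :
    ∃ T : Set (Set Ω), T.Countable ∧ (∀ B ∈ T, IsAtom P 𝓐 B) ∧ ⋃₀ T = Set.univ := by
  obtain ⟨S, hSc, hS, rfl⟩ := h
  exact ⟨insert (⋃₀ S)ᶜ S, hSc.insert _,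
    Set.forall_mem_insert.mpr ⟨isAtom_compl_sUnion hSc, hS⟩, by simp⟩

theorem CountablyAtomic.ae_of_forall_atom (h : CountablyAtomic P 𝓐) {p : Ω → Prop}
    (hp : ∀ B, IsAtom P 𝓐 B → P B ≠ 0 → ∀ᵐ ω ∂P.restrict B, p ω) : ∀ᵐ ω ∂P, p ω := by
  obtain ⟨T, hTc, hT, hTu⟩ := h.exists_cover
  rw [← Measure.restrict_univ (μ := P), ← hTu, Set.sUnion_eq_biUnion,
    ae_restrict_biUnion_iff _ hTc]
  intro B hB
  by_cases h0 : P B = 0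
  · simp [Measure.restrict_eq_zero.mpr h0]
  · exact hp B (hT B hB) h0

theorem CountablyAtomic.exists_atom_inter_ne_zero (h : CountablyAtomic P 𝓐) (hB : P B ≠ 0) :
    ∃ A, IsAtom P 𝓐 A ∧ P (A ∩ B) ≠ 0 := by
  obtain ⟨T, hTc, hT, hTu⟩ := h.exists_cover
  contrapose! hB
  rw [← Set.univ_inter B, ← hTu, Set.sUnion_eq_biUnion, Set.iUnion₂_inter,
    measure_biUnion_null_iff hTc]
  exact fun A hA => hB A (hT A hA)

variable [IsFiniteMeasure P]

theorem IsAtom.ae_eq_of_subset (h𝓐 : 𝓐 ≤ m) (hB : IsAtom P 𝓐 B) {A : Set Ω}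
    (hA : MeasurableSet[𝓐] A) (hAB : A ⊆ B) (hA0 : P A ≠ 0) : A =ᵐ[P] B :=
  ae_eq_of_subset_of_measure_ge hAB ((hB.2 A hAB hA).resolve_right hA0).ge
    (h𝓐 _ hA).nullMeasurableSet (measure_ne_top _ _)

theorem IsAtom.exists_parent {𝓑 : MeasurableSpace Ω} (h𝓐 : 𝓐 ≤ m) (h𝓑 : 𝓑 ≤ 𝓐)
    (hcount : CountablyAtomic P 𝓑) (hB : IsAtom P 𝓐 B) (hB0 : P B ≠ 0) :
    ∃ D, IsAtom P 𝓑 D ∧ (D ∩ B : Set Ω) =ᵐ[P] B := by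
  obtain ⟨D, hD, hDB⟩ := hcount.exists_atom_inter_ne_zero hB0
  exact ⟨D, hD, hB.ae_eq_of_subset h𝓐 ((h𝓑 _ hD.1).inter hB.1) Set.inter_subset_right hDB⟩

theorem IsAtom.condExp_ae_eq_average {E : Type*} [NormedAddCommGroup E] [NormedSpace ℝ E]
    [CompleteSpace E] (h𝓐 : 𝓐 ≤ m) (hB : IsAtom P 𝓐 B) {f : Ω → E} (hf : Integrable f P) :
    ∀ᵐ ω ∂P.restrict B, (P[f | 𝓐]) ω = ⨍ x in B, f x ∂P := by
  have hBm : MeasurableSet B := h𝓐 _ hB.1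
  have hconst : B.indicator (fun _ => ⨍ x in B, f x ∂P) =ᵐ[P] P[B.indicator f | 𝓐] := by
    refine ae_eq_condExp_of_forall_setIntegral_eq h𝓐 (hf.indicator hBm)
      (fun s _ _ => ((integrable_const _).indicator hBm).integrableOn) (fun s hs _ => ?_)
      (stronglyMeasurable_const.indicator hB.1).aestronglyMeasurable
    rw [setIntegral_indicator hBm, setIntegral_indicator hBm]
    by_cases h0 : P (s ∩ B) = 0
    · simp [Measure.restrict_eq_zero.mpr h0]
    · have hae := hB.ae_eq_of_subset h𝓐 (hs.inter hB.1) Set.inter_subset_right h0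
      rw [setIntegral_congr_set hae, setIntegral_congr_set hae, setIntegral_setAverage]
  filter_upwards [ae_restrict_of_ae (hconst.trans (condExp_indicator hf hB.1)),
    ae_restrict_mem hBm] with ω hω hωB
  simpa [hωB] using hω.symm

theorem IsAtom.condExp_indicator_one_ae_eq (h𝓐 : 𝓐 ≤ m) (hB : IsAtom P 𝓐 B) {A : Set Ω}
    (hA : MeasurableSet A) (hAB : A ⊆ B) :
    ∀ᵐ ω ∂P.restrict B, (P[A.indicator (1 : Ω → ℝ) | 𝓐]) ω = P.real A / P.real B := by
  filter_upwards [hB.condExp_ae_eq_average h𝓐 ((integrable_const (1 : ℝ)).indicator hA)] with ω hω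
  rw [div_eq_inv_mul, ← Set.inter_eq_left.mpr hAB, ← measureReal_restrict_apply hA,
    ← integral_indicator_one hA, Set.inter_eq_left.mpr hAB, ← smul_eq_mul, ← setAverage_eq]
  exact hω

/-- A Lebesgue differentiation theorem: the averages over the atoms determine `f` almost surely,
because they are the values of the closed martingale `E_n ‖f‖`, which converges to `‖f‖`. -/
theorem eLpNorm_top_le_of_setLAverage_le {E : Type*} [NormedAddCommGroup E]
    {ℱ : Filtration ℕ m} (hat : ∀ n, CountablyAtomic P (ℱ n)) {f : Ω → E}
    (hfm : StronglyMeasurable[⨆ n, ℱ n] f) (hf : Integrable f P) {M : ℝ≥0∞}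
    (hM : ∀ n B, IsAtom P (ℱ n) B → P B ≠ 0 → ⨍⁻ ω in B, ‖f ω‖ₑ ∂P ≤ M) :
    eLpNorm f ∞ P ≤ M := by
  have hcond : ∀ᵐ ω ∂P, ∀ n, ENNReal.ofReal ((P[fun x => ‖f x‖ | ℱ n]) ω) ≤ M := by
    refine ae_all_iff.mpr fun n => (hat n).ae_of_forall_atom fun B hB hB0 => ?_
    filter_upwards [hB.condExp_ae_eq_average (ℱ.le n) hf.norm] with ω hω
    rw [hω, ofReal_setAverage hf.norm.integrableOn (ae_of_all _ fun _ => norm_nonneg _)]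
    simpa [setLAverage_eq] using hM n B hB hB0
  rw [eLpNorm_exponent_top]
  refine eLpNormEssSup_le_of_ae_enorm_bound ?_
  filter_upwards [hcond, hf.norm.tendsto_ae_condExp hfm.norm] with ω hω hlim
  rw [← ofReal_norm]
  exact le_of_tendsto' (ENNReal.tendsto_ofReal hlim) hω

end Atoms

section Regular

variable {Ω : Type*} {m : MeasurableSpace Ω} {P : Measure Ω} [IsFiniteMeasure P]
  {ℱ : Filtration ℕ m} {r : ℝ≥0} {n : ℕ} {A B : Set Ω}

theorem IsRegularWith.one_le [NeZero P] (h : IsRegularWith ℱ P r) : 1 ≤ r := by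
  have hone := h (fun _ _ => 1) (martingale_const ℱ P 1)
    (fun _ => ae_of_all _ fun _ => zero_le_one) 0
  obtain ⟨_, hω⟩ := hone.exists
  simpa using hω

theorem IsRegularWith.measure_le (h : IsRegularWith ℱ P r) (hB : IsAtom P (ℱ n) B)
    (hA : MeasurableSet[ℱ (n + 1)] A) (hAB : A ⊆ B) (hA0 : P A ≠ 0) : P B ≤ r * P A := by
  have hAm : MeasurableSet A := ℱ.le _ _ hA
  have hreg := h _ (martingale_condExp (A.indicator 1) ℱ P)
    (fun _ => condExp_nonneg (ae_of_all _ (Set.indicator_nonneg fun _ _ => zero_le_one))) n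
  rw [condExp_of_stronglyMeasurable (ℱ.le _) (stronglyMeasurable_one.indicator hA)
    ((integrable_const (1 : ℝ)).indicator hAm)] at hreg
  have hle : ∀ᵐ _ ∂P.restrict A, (1 : ℝ) ≤ r * (P.real A / P.real B) := by
    filter_upwards [ae_restrict_of_ae hreg, ae_restrict_mem hAm,
      ae_restrict_of_ae_restrict_of_subset hAB
        (hB.condExp_indicator_one_ae_eq (ℱ.le n) hAm hAB)] with ω hω hωA hcond
    simpa [hcond, hωA] using hω
  have : NeZero (P A) := ⟨hA0⟩
  obtain ⟨_, hratio⟩ := hle.exists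
  have hB0 : 0 < P.real B :=
    ENNReal.toReal_pos (fun h0 => hA0 (measure_mono_null hAB h0)) (measure_ne_top _ _)
  rw [← mul_div_assoc, one_le_div hB0] at hratio
  rw [← ENNReal.toReal_le_toReal (by finiteness) (by finiteness), ENNReal.toReal_mul]
  exact hratio

theorem IsRegularWith.measure_le_of_sdiff_ne_zero (h : IsRegularWith ℱ P r)
    (hB : IsAtom P (ℱ n) B) (hA : MeasurableSet[ℱ (n + 1)] A) (hAB : A ⊆ B)
    (hBA : P (B \ A) ≠ 0) : P A ≤ (1 - r⁻¹ : ℝ≥0) * P B := by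
  have hdiff : P B ≤ r * P (B \ A) :=
    h.measure_le hB ((ℱ.mono n.le_succ _ hB.1).diff hA) Set.sdiff_subset hBA
  have hB0 : P B ≠ 0 := fun h0 => hBA (measure_mono_null Set.sdiff_subset h0)
  have hr : r ≠ 0 := by
    rintro rfl
    simp_all
  have hsum : P A + (r : ℝ≥0∞)⁻¹ * P B ≤ P B :=
    calc P A + (r : ℝ≥0∞)⁻¹ * P B ≤ P A + P (B \ A) := by
          gcongr
          rw [mul_comm, ← div_eq_mul_inv]
          exact ENNReal.div_le_of_le_mul' hdiff
      _ = P B := by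
          rw [measure_add_sdiff (ℱ.le _ _ hA).nullMeasurableSet, Set.union_eq_right.mpr hAB]
  rw [ENNReal.coe_sub, ENNReal.coe_one, ENNReal.coe_inv hr,
    ENNReal.sub_mul fun _ _ => measure_ne_top _ _, one_mul]
  exact ENNReal.le_sub_of_add_le_right (by finiteness) hsum

end Regular

section Lipschitz

variable {Ω : Type*} {m : MeasurableSpace Ω} {P : Measure Ω} {ℱ : Filtration ℕ m}
  {α : ℝ} {r : ℝ≥0} {L : ℝ≥0∞} {E : Type*} [NormedAddCommGroup E] [NormedSpace ℝ E] {f : Ω → E}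

/-- `L` bounds the `Lip_α` seminorm of `f`, stated for functions with values in a normed space and
with the averages over the atoms in place of the conditional expectations. -/
def IsLipWith (ℱ : Filtration ℕ m) (P : Measure Ω) (α : ℝ) (L : ℝ≥0∞) (f : Ω → E) : Prop :=
  ∀ ⦃n : ℕ⦄ ⦃B : Set Ω⦄, IsAtom P (ℱ n) B → P B ≠ 0 →
    meanOscillation (P.restrict B) f ≤ L * P B ^ α

/-- The sum `r ∑ₖ θᵏ = r / (1 - θ)` with `θ = (1 - 1 / r) ^ α`: along a decreasing chain of
distinct atoms of an `r`-regular filtration, `P(B) ^ α` decreases at least by the factor `θ`. -/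
noncomputable def chainConst (r : ℝ≥0) (α : ℝ) : ℝ≥0 := r / (1 - (1 - r⁻¹) ^ α)

theorem chainConst_mul_add (hα : 0 < α) (r : ℝ≥0) :
    chainConst r α * (1 - r⁻¹) ^ α + r = chainConst r α := by
  rcases eq_or_ne r 0 with rfl | hr
  · simp [chainConst]
  have hθ : (1 - r⁻¹) ^ α < 1 :=
    NNReal.rpow_lt_one (tsub_lt_self one_pos (inv_pos.mpr hr.bot_lt)) hα
  have hne : 1 - (1 - r⁻¹) ^ α ≠ 0 := (tsub_pos_of_lt hθ).ne'
  calc chainConst r α * (1 - r⁻¹) ^ α + r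
      = chainConst r α * ((1 - r⁻¹) ^ α + (1 - (1 - r⁻¹) ^ α)) := by
        rw [mul_add, chainConst, div_mul_cancel₀ _ hne]
    _ = chainConst r α := by rw [add_tsub_cancel_of_le hθ.le, mul_one]

theorem one_le_chainConst (hα : 0 < α) (hr : 1 ≤ r) : 1 ≤ chainConst r α :=
  hr.trans (le_add_self.trans_eq (chainConst_mul_add hα r))

theorem IsLipWith.mul [IsFiniteMeasure P] {A : Type*} [NormedRing A] [NormedAlgebra ℝ A]
    [CompleteSpace A] {f g : Ω → A} {M : ℝ≥0∞} (hLf : IsLipWith ℱ P α L f)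
    (hMg : IsLipWith ℱ P α M g) (hf : Integrable f P) (hg : Integrable g P)
    (hfg : Integrable (f * g) P) :
    IsLipWith ℱ P α (2 * (eLpNorm f ∞ P * M + eLpNorm g ∞ P * L)) (f * g) := fun n B hB hB0 => by
  have : NeZero (P B) := ⟨hB0⟩
  calc meanOscillation (P.restrict B) (f * g)
      ≤ 2 * (eLpNorm f ∞ (P.restrict B) * meanOscillation (P.restrict B) g +
          eLpNorm g ∞ (P.restrict B) * meanOscillation (P.restrict B) f) :=
        meanOscillation_mul_le hf.restrict hg.restrict hfg.restrict
    _ ≤ 2 * (eLpNorm f ∞ P * (M * P B ^ α) + eLpNorm g ∞ P * (L * P B ^ α)) := by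
        gcongr
        · exact Measure.restrict_le_self
        · exact hMg hB hB0
        · exact Measure.restrict_le_self
        · exact hLf hB hB0
    _ = 2 * (eLpNorm f ∞ P * M + eLpNorm g ∞ P * L) * P B ^ α := by ring

variable [CompleteSpace E]

theorem enorm_setAverage_sub_setAverage_le [IsFiniteMeasure P] (hf : Integrable f P)
    {A B : Set Ω} (hAB : A ⊆ B) (hA0 : P A ≠ 0) {r : ℝ≥0∞} (hr : P B ≤ r * P A) :
    ‖⨍ x in A, f x ∂P - ⨍ x in B, f x ∂P‖ₑ ≤ r * meanOscillation (P.restrict B) f := by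
  have : NeZero (P A) := ⟨hA0⟩
  exact (enorm_average_sub_le hf.restrict _).trans
    (laverage_mono_measure (Measure.restrict_mono_set P hAB) (by simpa using hr)
      (by simpa using hA0) (by simp) _)

/-- Passing from an atom to an atom inside it, the growth of the average is paid for by the decrease
of `P(B) ^ α`. -/
theorem IsRegularWith.enorm_setAverage_add_le [IsFiniteMeasure P] (h : IsRegularWith ℱ P r)
    (hα : 0 < α) (hf : Integrable f P) (hL : IsLipWith ℱ P α L f) {n : ℕ} {A B : Set Ω}
    (hB : IsAtom P (ℱ n) B) (hA : MeasurableSet[ℱ (n + 1)] A) (hAB : A ⊆ B) (hA0 : P A ≠ 0) :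
    ‖⨍ x in A, f x ∂P‖ₑ + chainConst r α * L * P A ^ α ≤
      ‖⨍ x in B, f x ∂P‖ₑ + chainConst r α * L * P B ^ α := by
  by_cases hBA : P (B \ A) = 0
  · have hae : A =ᵐ[P] B := hAB.eventuallyLE.antisymm (ae_le_set.mpr hBA)
    rw [setAverage_congr hae, measure_congr hae]
  have hB0 : P B ≠ 0 := fun h0 => hA0 (measure_mono_null hAB h0)
  have havg : ‖⨍ x in A, f x ∂P‖ₑ ≤ ‖⨍ x in B, f x ∂P‖ₑ + r * (L * P B ^ α) :=
    calc ‖⨍ x in A, f x ∂P‖ₑ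
        ≤ ‖⨍ x in B, f x ∂P‖ₑ + ‖⨍ x in A, f x ∂P - ⨍ x in B, f x ∂P‖ₑ := by
          simpa using enorm_add_le (⨍ x in B, f x ∂P) (⨍ x in A, f x ∂P - ⨍ x in B, f x ∂P)
      _ ≤ ‖⨍ x in B, f x ∂P‖ₑ + r * (L * P B ^ α) := by
          gcongr
          exact (enorm_setAverage_sub_setAverage_le hf hAB hA0 (h.measure_le hB hA hAB hA0)).trans
            (by gcongr; exact hL hB hB0)
  have hpow : P A ^ α ≤ ((1 - r⁻¹) ^ α : ℝ≥0) * P B ^ α := by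
    rw [ENNReal.coe_rpow_of_nonneg _ hα.le, ← ENNReal.mul_rpow_of_nonneg _ _ hα.le]
    gcongr
    exact h.measure_le_of_sdiff_ne_zero hB hA hAB hBA
  calc ‖⨍ x in A, f x ∂P‖ₑ + chainConst r α * L * P A ^ α
      ≤ ‖⨍ x in B, f x ∂P‖ₑ + r * (L * P B ^ α) +
          chainConst r α * L * (((1 - r⁻¹) ^ α : ℝ≥0) * P B ^ α) := by gcongr
    _ = ‖⨍ x in B, f x ∂P‖ₑ + (chainConst r α * (1 - r⁻¹) ^ α + r : ℝ≥0) * L * P B ^ α := by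
        push_cast; ring
    _ = ‖⨍ x in B, f x ∂P‖ₑ + chainConst r α * L * P B ^ α := by rw [chainConst_mul_add hα]

variable [IsProbabilityMeasure P]

theorem IsRegularWith.enorm_setAverage_add_le_integral (h : IsRegularWith ℱ P r) (hα : 0 < α)
    (h0 : ℱ 0 = ⊥) (hat : ∀ n, CountablyAtomic P (ℱ n)) (hf : Integrable f P)
    (hL : IsLipWith ℱ P α L f) (n : ℕ) {B : Set Ω} (hB : IsAtom P (ℱ n) B) (hB0 : P B ≠ 0) :
    ‖⨍ x in B, f x ∂P‖ₑ + chainConst r α * L * P B ^ α ≤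
      ‖∫ x, f x ∂P‖ₑ + chainConst r α * L := by
  induction n generalizing B with
  | zero =>
    rcases MeasurableSpace.measurableSet_bot_iff.mp (h0 ▸ hB.1) with rfl | rfl
    · simp at hB0
    · simp [average_eq_integral]
  | succ n ih =>
    obtain ⟨D, hD, hae⟩ := hB.exists_parent (ℱ.le _) (ℱ.mono n.le_succ) (hat n) hB0
    have hDB0 : P (D ∩ B) ≠ 0 := by rwa [measure_congr hae]
    have hD0 : P D ≠ 0 := fun h => hDB0 (measure_mono_null Set.inter_subset_left h)
    rw [← setAverage_congr hae, ← measure_congr hae]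
    exact (h.enorm_setAverage_add_le hα hf hL hD ((ℱ.mono n.le_succ _ hD.1).inter hB.1)
      Set.inter_subset_left hDB0).trans (ih hD hD0)

theorem IsRegularWith.eLpNorm_top_le (h : IsRegularWith ℱ P r) (hα : 0 < α) (h0 : ℱ 0 = ⊥)
    (hat : ∀ n, CountablyAtomic P (ℱ n)) (hfm : StronglyMeasurable[⨆ n, ℱ n] f)
    (hf : Integrable f P) (hL : IsLipWith ℱ P α L f) :
    eLpNorm f ∞ P ≤ ‖∫ x, f x ∂P‖ₑ + chainConst r α * L := by
  refine eLpNorm_top_le_of_setLAverage_le hat hfm hf fun n B hB hB0 => ?_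
  have : NeZero (P B) := ⟨hB0⟩
  calc ⨍⁻ ω in B, ‖f ω‖ₑ ∂P
      ≤ ‖⨍ x in B, f x ∂P‖ₑ + meanOscillation (P.restrict B) f := laverage_enorm_le f
    _ ≤ ‖⨍ x in B, f x ∂P‖ₑ + chainConst r α * (L * P B ^ α) := by
        gcongr
        exact (hL hB hB0).trans
          (le_mul_of_one_le_left' (mod_cast one_le_chainConst hα h.one_le))
    _ ≤ ‖∫ x, f x ∂P‖ₑ + chainConst r α * L := by
        rw [← mul_assoc]
        exact h.enorm_setAverage_add_le_integral hα h0 hat hf hL n hB hB0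

end Lipschitz

section Multipliers

variable {Ω : Type*} {m : MeasurableSpace Ω} {P : Measure Ω} {ℱ : Filtration ℕ m} {α : ℝ}
  {𝕜 : Type*} [RCLike 𝕜] {f g : Ω → 𝕜}

theorem PWM_subset {X : Set (Ω → 𝕜)} (h1 : 1 ∈ X) : PWM X ⊆ X := fun g hg => by
  simpa using hg.2 1 h1

theorem opNorm_le {X : Set (Ω → 𝕜)} {N : (Ω → 𝕜) → ℝ≥0∞} {C : ℝ≥0∞}
    (h : ∀ f ∈ X, N (f * g) ≤ C * N f) : opNorm P X N g ≤ C :=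
  iSup₂_le fun f hf => iSup_le fun _ => ENNReal.div_le_of_le_mul (h f hf)

theorem div_le_opNorm [NeZero P] {X : Set (Ω → 𝕜)} (h1 : 1 ∈ X) (N : (Ω → 𝕜) → ℝ≥0∞)
    (g : Ω → 𝕜) : N g / N 1 ≤ opNorm P X N g := by
  have hne : ¬ (1 : Ω → 𝕜) =ᵐ[P] 0 := fun h => by
    obtain ⟨_, h⟩ := h.exists
    exact one_ne_zero h
  exact le_iSup₂_of_le 1 h1 (le_iSup_of_le hne (by rw [one_mul]))

theorem lipNorm_eq (f : Ω → 𝕜) : lipNorm ℱ P α f = lipSeminorm ℱ P α f + ‖∫ ω, f ω ∂P‖ₑ := rfl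

theorem lipSeminorm_le_lipNorm (f : Ω → 𝕜) : lipSeminorm ℱ P α f ≤ lipNorm ℱ P α f := le_self_add

theorem LipNat_eq_Lip : LipNat 𝕜 ℱ P α = Lip 𝕜 ℱ P α := by
  ext f
  simp [LipNat, Lip, lipNorm_eq, ENNReal.add_lt_top]

theorem lipSeminorm_le_iff [IsFiniteMeasure P] (hf : Integrable f P) {L : ℝ≥0∞} :
    lipSeminorm ℱ P α f ≤ L ↔ IsLipWith ℱ P α L f := by
  simp only [lipSeminorm, campanatoSeminorm, iSup_le_iff, IsLipWith]
  refine forall₄_congr fun n B hB hB0 => ?_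
  have hosc : ⨍⁻ ω in B, ‖f ω - (P[f | ℱ n]) ω‖ₑ ^ (1 : ℝ) ∂P =
      meanOscillation (P.restrict B) f := by
    refine laverage_congr ?_
    filter_upwards [hB.condExp_ae_eq_average (ℱ.le n) hf] with ω hω
    rw [hω, ENNReal.rpow_one]
  have hpow : ENNReal.ofReal (P.real B ^ α) = P B ^ α := by
    have hBpos : 0 < P.real B := ENNReal.toReal_pos hB0 (measure_ne_top _ _)
    rw [← ENNReal.ofReal_rpow_of_pos hBpos, ofReal_measureReal]
  rw [hosc, hpow, div_one, ENNReal.rpow_one, ENNReal.div_le_iff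
    (ENNReal.rpow_pos hB0.bot_lt (measure_ne_top _ _)).ne'
    (ENNReal.rpow_ne_top_of_ne_zero hB0 (measure_ne_top _ _))]

theorem isLipWith_lipSeminorm [IsFiniteMeasure P] (hf : Integrable f P) :
    IsLipWith ℱ P α (lipSeminorm ℱ P α f) f :=
  (lipSeminorm_le_iff hf).mp le_rfl

variable [IsProbabilityMeasure P]

theorem lipNorm_one : lipNorm ℱ P α (1 : Ω → 𝕜) = 1 := by
  have hzero : lipSeminorm ℱ P α (1 : Ω → 𝕜) ≤ 0 :=
    (lipSeminorm_le_iff (integrable_const (1 : 𝕜))).mpr fun n B _ hB0 => by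
      have : NeZero (P B) := ⟨hB0⟩
      exact (meanOscillation_const (1 : 𝕜)).trans_le zero_le
  simp [lipNorm_eq, nonpos_iff_eq_zero.mp hzero]

theorem one_mem_LipNat : (1 : Ω → 𝕜) ∈ LipNat 𝕜 ℱ P α :=
  ⟨⟨measurable_one, integrable_const (1 : 𝕜)⟩, lipNorm_one.trans_lt ENNReal.one_lt_top⟩

theorem lipNorm_le_opNorm (g : Ω → 𝕜) :
    lipNorm ℱ P α g ≤ opNorm P (LipNat 𝕜 ℱ P α) (lipNorm ℱ P α) g := by
  simpa [lipNorm_one] using div_le_opNorm (P := P) one_mem_LipNat (lipNorm ℱ P α) g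

theorem lipNorm_mul_le (hf : Integrable f P) (hg : Integrable g P) (hfg : Integrable (f * g) P) :
    lipNorm ℱ P α (f * g) ≤
      2 * (eLpNorm f ∞ P * lipSeminorm ℱ P α g + eLpNorm g ∞ P * lipSeminorm ℱ P α f) +
        eLpNorm f ∞ P * eLpNorm g ∞ P := by
  have hint : ‖∫ ω, (f * g) ω ∂P‖ₑ ≤ eLpNorm (f * g) ∞ P := by
    simpa [average_eq_integral] using enorm_average_le_eLpNorm_top P (f * g)
  have hsmul : eLpNorm (f * g) ∞ P ≤ eLpNorm f ∞ P * eLpNorm g ∞ P :=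
    (eLpNorm_le_eLpNorm_top_mul_eLpNorm ∞ f hg.1 (· * ·) 1
      (ae_of_all P fun _ => by simp)).trans_eq (by simp)
  rw [lipNorm_eq]
  gcongr
  · exact (lipSeminorm_le_iff hfg).mpr
      ((isLipWith_lipSeminorm hf).mul (isLipWith_lipSeminorm hg) hf hg hfg)
  · exact hint.trans hsmul

/-- The embedding `Lip♮_α ⊆ L_∞` with norm at most `K`. -/
def LipNatEmbedsLinfty (𝕜 : Type*) [RCLike 𝕜] (ℱ : Filtration ℕ m) (P : Measure Ω) (α : ℝ)
    (K : ℝ≥0) : Prop :=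
  ∀ f ∈ LipNat 𝕜 ℱ P α, eLpNorm f ∞ P ≤ K * lipNorm ℱ P α f

theorem IsRegularWith.lipNatEmbedsLinfty {r : ℝ≥0} (h : IsRegularWith ℱ P r) (hα : 0 < α)
    (hm : ⨆ n, ℱ n = m) (h0 : ℱ 0 = ⊥) (hat : ∀ n, CountablyAtomic P (ℱ n)) :
    LipNatEmbedsLinfty 𝕜 ℱ P α (chainConst r α) := fun f hf => by
  have hfm : StronglyMeasurable[⨆ n, ℱ n] f := hm.symm ▸ hf.1.1.stronglyMeasurable
  calc eLpNorm f ∞ P ≤ ‖∫ x, f x ∂P‖ₑ + chainConst r α * lipSeminorm ℱ P α f :=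
        h.eLpNorm_top_le hα h0 hat hfm hf.1.2 (isLipWith_lipSeminorm hf.1.2)
    _ ≤ chainConst r α * ‖∫ x, f x ∂P‖ₑ + chainConst r α * lipSeminorm ℱ P α f := by
        gcongr
        exact le_mul_of_one_le_left' (mod_cast one_le_chainConst hα h.one_le)
    _ = chainConst r α * lipNorm ℱ P α f := by
        rw [← mul_add, add_comm, lipNorm_eq]

namespace LipNatEmbedsLinfty

variable {K : ℝ≥0}

theorem one_le (h : LipNatEmbedsLinfty 𝕜 ℱ P α K) : 1 ≤ K := by
  have hone : eLpNorm (1 : Ω → 𝕜) ∞ P = 1 := by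
    simp [eLpNorm_exponent_top, Pi.one_def, eLpNormEssSup_const _ (NeZero.ne P)]
  have h1 := h 1 one_mem_LipNat
  rw [hone, lipNorm_one, mul_one] at h1
  exact_mod_cast h1

theorem lipNorm_mul_le (h : LipNatEmbedsLinfty 𝕜 ℱ P α K) (hf : f ∈ LipNat 𝕜 ℱ P α)
    (hg : g ∈ Lip 𝕜 ℱ P α ∩ Linfty 𝕜 P) :
    lipNorm ℱ P α (f * g) ≤
      (3 * K : ℝ≥0) * (lipSeminorm ℱ P α g + eLpNorm g ∞ P) * lipNorm ℱ P α f := by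
  have hKf : eLpNorm f ∞ P ≤ K * lipNorm ℱ P α f := h f hf
  have hLf : lipSeminorm ℱ P α f ≤ K * lipNorm ℱ P α f :=
    (lipSeminorm_le_lipNorm f).trans (le_mul_of_one_le_left' (mod_cast h.one_le))
  calc lipNorm ℱ P α (f * g)
      ≤ 2 * (eLpNorm f ∞ P * lipSeminorm ℱ P α g + eLpNorm g ∞ P * lipSeminorm ℱ P α f) +
          eLpNorm f ∞ P * eLpNorm g ∞ P :=
        MartingaleCampanato.lipNorm_mul_le hf.1.2 hg.1.1.2 (hf.1.2.mul_of_top_left hg.2.2)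
    _ ≤ 2 * (K * lipNorm ℱ P α f * lipSeminorm ℱ P α g +
          eLpNorm g ∞ P * (K * lipNorm ℱ P α f)) + K * lipNorm ℱ P α f * eLpNorm g ∞ P := by gcongr
    _ = K * lipNorm ℱ P α f * (2 * lipSeminorm ℱ P α g + 3 * eLpNorm g ∞ P) := by ring
    _ ≤ K * lipNorm ℱ P α f * (3 * lipSeminorm ℱ P α g + 3 * eLpNorm g ∞ P) := by
        gcongr
        norm_num
    _ = (3 * K : ℝ≥0) * (lipSeminorm ℱ P α g + eLpNorm g ∞ P) * lipNorm ℱ P α f := by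
        push_cast; ring

theorem PWM_eq (h : LipNatEmbedsLinfty 𝕜 ℱ P α K) :
    PWM (LipNat 𝕜 ℱ P α) = Lip 𝕜 ℱ P α ∩ Linfty 𝕜 P := by
  refine Set.Subset.antisymm (fun g hg => ?_) fun g hg => ⟨hg.2.1, fun f hf => ?_⟩
  · have hgX : g ∈ LipNat 𝕜 ℱ P α := PWM_subset one_mem_LipNat hg
    exact ⟨LipNat_eq_Lip.subset hgX, hg.1, hgX.1.1.aestronglyMeasurable,
      (h g hgX).trans_lt (ENNReal.mul_lt_top ENNReal.coe_lt_top hgX.2)⟩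
  · refine ⟨⟨hf.1.1.mul hg.2.1, hf.1.2.mul_of_top_left hg.2.2⟩,
      (h.lipNorm_mul_le hf hg).trans_lt ?_⟩
    exact ENNReal.mul_lt_top (ENNReal.mul_lt_top ENNReal.coe_lt_top
      (ENNReal.add_lt_top.mpr ⟨hg.1.2, hg.2.2.2⟩)) hf.2

theorem opNorm_le (h : LipNatEmbedsLinfty 𝕜 ℱ P α K) (hg : g ∈ PWM (LipNat 𝕜 ℱ P α)) :
    opNorm P (LipNat 𝕜 ℱ P α) (lipNorm ℱ P α) g ≤
      (3 * K : ℝ≥0) * (lipSeminorm ℱ P α g + eLpNorm g ∞ P) :=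
  MartingaleCampanato.opNorm_le fun _ hf => h.lipNorm_mul_le hf (h.PWM_eq ▸ hg)

theorem le_opNorm (h : LipNatEmbedsLinfty 𝕜 ℱ P α K) (hg : g ∈ PWM (LipNat 𝕜 ℱ P α)) :
    lipSeminorm ℱ P α g + eLpNorm g ∞ P ≤
      (3 * K : ℝ≥0) * opNorm P (LipNat 𝕜 ℱ P α) (lipNorm ℱ P α) g := by
  have hK : 1 + K ≤ 3 * K := by linarith [h.one_le]
  calc lipSeminorm ℱ P α g + eLpNorm g ∞ P ≤ lipNorm ℱ P α g + K * lipNorm ℱ P α g :=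
        add_le_add (lipSeminorm_le_lipNorm g) (h g (PWM_subset one_mem_LipNat hg))
    _ = (1 + K : ℝ≥0) * lipNorm ℱ P α g := by push_cast; ring
    _ ≤ (3 * K : ℝ≥0) * opNorm P (LipNat 𝕜 ℱ P α) (lipNorm ℱ P α) g := by
        gcongr
        exact lipNorm_le_opNorm g

end LipNatEmbedsLinfty

end Multipliers

end MartingaleCampanato

open MartingaleCampanato in
theorem corollary1p3 {𝕜 : Type*} [RCLike 𝕜] (α R : ℝ) (hα : 0 < α) (hR : 2 ≤ R) :
    ∃ C : ℝ≥0, 0 < C ∧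
      ∀ {Ω : Type*} {m : MeasurableSpace Ω} (P : Measure Ω) [IsProbabilityMeasure P]
        (ℱ : Filtration ℕ m),
        (⨆ n, ℱ n) = m →
        (∀ n, MartingaleCampanato.CountablyAtomic P (ℱ n)) →
        ℱ 0 = ⊥ →
        MartingaleCampanato.IsRegularWith ℱ P R →
        MartingaleCampanato.PWM (MartingaleCampanato.LipNat 𝕜 ℱ P α) =
            MartingaleCampanato.Lip 𝕜 ℱ P α ∩ MartingaleCampanato.Linfty 𝕜 P ∧
        ∀ g ∈ MartingaleCampanato.PWM (MartingaleCampanato.LipNat 𝕜 ℱ P α),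
          MartingaleCampanato.opNorm P (MartingaleCampanato.LipNat 𝕜 ℱ P α)
              (MartingaleCampanato.lipNorm ℱ P α) g ≤
            C * (MartingaleCampanato.lipSeminorm ℱ P α g + eLpNorm g ∞ P) ∧
          MartingaleCampanato.lipSeminorm ℱ P α g + eLpNorm g ∞ P ≤
            C * MartingaleCampanato.opNorm P (MartingaleCampanato.LipNat 𝕜 ℱ P α)
              (MartingaleCampanato.lipNorm ℱ P α) g := by
  lift R to ℝ≥0 using by positivity
  have hR' : 1 ≤ R := one_le_two.trans (mod_cast hR)
  have hK : 0 < chainConst R α := one_pos.trans_le (one_le_chainConst hα hR')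
  refine ⟨3 * chainConst R α, by positivity, fun P _ ℱ hm hat h0 hreg => ?_⟩
  have hemb := hreg.lipNatEmbedsLinfty (𝕜 := 𝕜) hα hm h0 hat
  exact ⟨hemb.PWM_eq, fun g hg => ⟨hemb.opNorm_le hg, hemb.le_opNorm hg⟩⟩
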